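/- Let $n\ge 2$ and let $\Omega\subset\mathbb R^n$ be admissible, i.e. $\Omega$ is closed and its boundary $\partial\Omega$ has $n$-dimensional Lebesgue measure $0$. For $t>0$ and $x\in\mathbb R^n$ let $$f_\Omega(t,x)=\int_\Omega \frac{1}{(4\pi t)^{n/2}}\,e^{-|x-y|^2/(4t)}\,dy$$ be the temperature at time $t$ and place $x$ for the heat flow $\partial_t f=\Delta f$ on $\mathbb R^n$ with initial temperature the characteristic function $\chi_\Omega$. A point $z\in\partial\Omega$ is called a smooth boundary point if there are an open neighbourhood $U$ of $z$ and a $C^\infty$ function $\varphi:U\to\mathbb R$ with $\varphi(z)=0$, $\nabla\varphi(z)\ne 0$ and $\Omega\cap U=\{x\in U:\varphi(x)\le 0\}$. Near such a point $\partial\Omega$ is a smooth hypersurface with outer unit normal field $\nu=\nabla\varphi/|\nabla\varphi|$, and the mean curvature of $\partial\Omega$ at $z$ with respect to $\nu$ is $$H_{\partial\Omega}(z)=\frac{1}{n-1}\,\mathrm{tr}(L_z),\qquad L_z:T_z\partial\Omega\to T_z\partial\Omega,\quad L_z\xi=D_\xi\nu,$$ which does not depend on the choice of $\varphi$ (so a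 ball of radius $R$ has mean curvature $1/R$). Let $z_1,z_2\in\partial\Omega$ be smooth boundary points with $H_{\partial\Omega}(z_1)<H_{\partial\Omega}(z_2)$. Then $(z_1,\Omega,\mathbb R^n)$ is initially strictly hotter than $(z_2,\Omega,\mathbb R^n)$: there is $\tau>0$ such that $$f_\Omega(t,z_1)>f_\Omega(t,z_2)\qquad\text{for all } t\in(0,\tau).$$ -/

import Mathlib

open scoped ContDiff

noncomputable section

namespace HeatComparison

/-- The Euclidean space `ℝⁿ`. -/
abbrev Euc (n : ℕ) : Type := EuclideanSpace ℝ (Fin n)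

/-- Admissible sets: closed sets whose topological boundary is a null set. -/
def IsAdmissible {n : ℕ} (Ω : Set (Euc n)) : Prop :=
  IsClosed Ω ∧ MeasureTheory.volume (frontier Ω) = 0

/-- The heat kernel of `ℝⁿ`, `k(t,x,y) = (4πt)^(-n/2) exp(-|x-y|²/(4t))`. -/
def heatKernel {n : ℕ} (t : ℝ) (x y : Euc n) : ℝ :=
  (4 * Real.pi * t) ^ (-((n : ℝ) / 2)) * Real.exp (-(‖x - y‖ ^ 2 / (4 * t)))

/-- The temperature `f_Ω(t,x) = ∫_Ω k(t,x,y) dy` at time `t` and place `x`, for the heat flow with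
initial temperature the characteristic function of `Ω`. -/
def temperature {n : ℕ} (Ω : Set (Euc n)) (t : ℝ) (x : Euc n) : ℝ :=
  ∫ y in Ω, heatKernel t x y

/-- `(x₁, Ω₁, ℝᵐ)` is initially strictly hotter than `(x₂, Ω₂, ℝⁿ)`. -/
def InitiallyStrictlyHotter {m n : ℕ} (x₁ : Euc m) (Ω₁ : Set (Euc m))
    (x₂ : Euc n) (Ω₂ : Set (Euc n)) : Prop :=
  ∃ τ : ℝ, 0 < τ ∧ ∀ t ∈ Set.Ioo (0 : ℝ) τ, temperature Ω₂ t x₂ < temperature Ω₁ t x₁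

/-- `φ` is a smooth defining function of `Ω` on an open neighbourhood `U` of the boundary point
`z`: in `U`, the set `Ω` is the sublevel set `{φ ≤ 0}`, and `φ` has `z` as a regular zero.
After shrinking `U`, `∂Ω ∩ U` is the smooth hypersurface `{φ = 0}` and `Ω` lies on the side to
which `-∇φ` points, so that `∇φ` is an outer normal. -/
structure IsDefiningFunctionAt {n : ℕ} (Ω : Set (Euc n)) (z : Euc n)
    (U : Set (Euc n)) (φ : Euc n → ℝ) : Prop where
  isOpen : IsOpen U
  mem : z ∈ U
  smooth : ContDiffOn ℝ ∞ φ U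
  eq_zero : φ z = 0
  gradient_ne_zero : gradient φ z ≠ 0
  mem_iff : ∀ x ∈ U, x ∈ Ω ↔ φ x ≤ 0

/-- The unit normal field `ν = ∇φ / |∇φ|` of the level sets of `φ`; along the boundary of
`{φ ≤ 0}` it is the outer unit normal. -/
def unitNormal {n : ℕ} (φ : Euc n → ℝ) (x : Euc n) : Euc n :=
  ‖gradient φ x‖⁻¹ • gradient φ x

/-- The tangent space at `z` of the level set of `φ` through `z`: the orthogonal complement of the
normal vector. -/
def tangentPlane {n : ℕ} (φ : Euc n → ℝ) (z : Euc n) : Submodule ℝ (Euc n) :=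
  (Submodule.span ℝ {gradient φ z})ᗮ

/-- The Weingarten map `ξ ↦ D_ξ ν` of the tangent space. The derivative of the unit field `ν`
is already tangential; the orthogonal projection only records this in the type. -/
def weingartenMap {n : ℕ} (φ : Euc n → ℝ) (z : Euc n) :
    tangentPlane φ z →ₗ[ℝ] tangentPlane φ z :=
  ((tangentPlane φ z).orthogonalProjectionOnto ∘L fderiv ℝ (unitNormal φ) z ∘L
    (tangentPlane φ z).subtypeL : tangentPlane φ z →L[ℝ] tangentPlane φ z)

/-- `z` is a smooth boundary point of `Ω`, and `∂Ω` has at `z` the mean curvature `H`, the trace of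
the Weingarten map for the outer unit normal divided by `n - 1`. The value does not depend on the
defining function. The sign is such that balls have positive mean curvature. -/
def HasMeanCurvatureAt {n : ℕ} (Ω : Set (Euc n)) (z : Euc n) (H : ℝ) : Prop :=
  ∃ (U : Set (Euc n)) (φ : Euc n → ℝ), IsDefiningFunctionAt Ω z U φ ∧
    H = LinearMap.trace ℝ (tangentPlane φ z) (weingartenMap φ z) / ((n : ℝ) - 1)

end HeatComparison

end

noncomputable section

namespace HeatComparison

open MeasureTheory Filter Topology

/-! At time `t = s²` the heat kernel sees `Ω` at scale `s` around `z`, where `Ω` differs from its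
tangent half space by a quadratic correction. Put `z + s²v·ν + s·ζ`, with `ζ` tangential with
coordinates `ξ`. After division by `s²` the inequality `φ ≤ 0` tends to `v ≤ -q(ξ)`, where `q` is
half the second fundamental form. The Gaussian weight tends to `exp(-|ξ|²/4)`.

That limit weight no longer decays in `v`, so the half space `v ≤ 0` is subtracted before the limit
is taken. Its contribution is the same at every boundary point and drops out of the comparison. What
remains, `halfSpaceDefect`, has an integrable majorant uniform in `s`
(`exists_halfSpaceDefect_bound`). By dominated convergence and integration in `v`, its integral
tends to `-∫ q(ξ) exp(-|ξ|²/4) dξ`. Mixed second moments vanish, so only the trace of `q` survives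
and the limit is `-K·H` with `K > 0` depending on the dimension alone
(`exists_tendsto_integral_halfSpaceDefect`). Since the temperature is a positive factor depending
only on `s` and the dimension times (half-space term + defect), smaller `H` means hotter for small
`t`. -/

/-! ### Parabolic coordinates and the change of variables. -/

/-- Parabolic coordinates at `z` adapted to an orthonormal basis `b`: the normal coordinate is
scaled by `s²`, the tangential ones by `s`. -/
def parabolicChart {m : ℕ} (z : Euc (m + 1)) (b : OrthonormalBasis (Fin (m + 1)) ℝ (Euc (m + 1)))
    (s : ℝ) (p : ℝ × (Fin m → ℝ)) : Euc (m + 1) :=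
  z + ((s ^ 2 * p.1) • b 0 + s • ∑ i, p.2 i • b i.succ)

/-- The Gaussian weight of the heat kernel at time `s²` in parabolic coordinates. -/
def parabolicWeight {m : ℕ} (s : ℝ) (p : ℝ × (Fin m → ℝ)) : ℝ :=
  Real.exp (-((s ^ 2 * p.1 ^ 2 + ∑ i, p.2 i ^ 2) / 4))

lemma continuous_parabolicChart {m : ℕ} (z : Euc (m + 1))
    (b : OrthonormalBasis (Fin (m + 1)) ℝ (Euc (m + 1))) (s : ℝ) :
    Continuous (parabolicChart z b s) := by
  unfold parabolicChart
  fun_prop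

lemma continuous_parabolicWeight {m : ℕ} (s : ℝ) :
    Continuous (parabolicWeight (m := m) s) := by
  unfold parabolicWeight
  fun_prop

lemma norm_sq_normal_add_tangential {m : ℕ}
    (b : OrthonormalBasis (Fin (m + 1)) ℝ (Euc (m + 1))) (v : ℝ) (ξ : Fin m → ℝ) :
    ‖v • b 0 + ∑ i, ξ i • b i.succ‖ ^ 2 = v ^ 2 + ∑ i, ξ i ^ 2 := by
  have h : v • b 0 + ∑ i, ξ i • b i.succ = ∑ i, (Fin.cons v ξ : Fin (m + 1) → ℝ) i • b i := by
    simp [Fin.sum_univ_succ]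
  rw [h, ← real_inner_self_eq_norm_sq, b.orthonormal.inner_sum, Fin.sum_univ_succ]
  simp [sq]

lemma norm_sq_parabolicChart_sub {m : ℕ} (z : Euc (m + 1))
    (b : OrthonormalBasis (Fin (m + 1)) ℝ (Euc (m + 1))) (s : ℝ) (p : ℝ × (Fin m → ℝ)) :
    ‖parabolicChart z b s p - z‖ ^ 2 = s ^ 2 * (s ^ 2 * p.1 ^ 2 + ∑ i, p.2 i ^ 2) := by
  have h : parabolicChart z b s p - z
      = (s ^ 2 * p.1) • b 0 + ∑ i, (s • p.2) i • b i.succ := by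
    simp [parabolicChart, Finset.smul_sum, smul_smul]
  rw [h, norm_sq_normal_add_tangential]
  simp only [Pi.smul_apply, smul_eq_mul, mul_pow, ← Finset.mul_sum]
  ring

/-- Integration in the coordinates of an orthonormal basis, the first one split off. -/
lemma integral_eq_integral_normal_tangential {m : ℕ} (z : Euc (m + 1))
    (b : OrthonormalBasis (Fin (m + 1)) ℝ (Euc (m + 1))) (g : Euc (m + 1) → ℝ) :
    ∫ y, g y = ∫ p : ℝ × (Fin m → ℝ), g (z + (p.1 • b 0 + ∑ i, p.2 i • b i.succ)) := by
  rw [← integral_add_left_eq_self (μ := volume) g z]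
  rw [← b.measurePreserving_repr_symm.integral_comp'
    (f := b.measurableEquiv.symm) (g := fun y => g (z + y))]
  rw [← (EuclideanSpace.volume_preserving_symm_measurableEquiv_toLp (Fin (m + 1))).symm.integral_comp'
    (g := fun w => g (z + b.measurableEquiv.symm w))]
  rw [← (volume_preserving_piFinSuccAbove (fun _ : Fin (m + 1) => ℝ) 0).symm.integral_comp'
    (g := fun w => g (z + b.measurableEquiv.symm
      ((MeasurableEquiv.toLp 2 (Fin (m + 1) → ℝ)).symm.symm w)))]
  refine integral_congr_ae (ae_of_all _ fun p => ?_)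
  have h : b.measurableEquiv.symm ((MeasurableEquiv.toLp 2 (Fin (m + 1) → ℝ)).symm.symm
      ((MeasurableEquiv.piFinSuccAbove (fun _ : Fin (m + 1) => ℝ) 0).symm p))
      = p.1 • b 0 + ∑ i, p.2 i • b i.succ := by
    change b.repr.symm (WithLp.toLp 2 (Fin.insertNth 0 p.1 p.2)) = _
    rw [← b.sum_repr_symm, Fin.sum_univ_succ]
    simp
  simp only [h]

/-- The Jacobian is `s²` from the normal direction times `s^m` from the tangential ones. -/
lemma map_parabolic_scaling {m : ℕ} {s : ℝ} (hs : 0 < s) :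
    Measure.map (fun p : ℝ × (Fin m → ℝ) => (s ^ 2 * p.1, s • p.2)) volume
      = ENNReal.ofReal ((s ^ (m + 2))⁻¹) • (volume : Measure (ℝ × (Fin m → ℝ))) := by
  have hs2 : s ^ 2 ≠ 0 := by positivity
  have h := Measure.map_prod_map (volume : Measure ℝ) (volume : Measure (Fin m → ℝ))
    (f := fun v : ℝ => s ^ 2 • v) (g := fun ξ => s • ξ) (by fun_prop) (by fun_prop)
  rw [Measure.map_addHaar_smul _ hs2, Measure.map_addHaar_smul _ hs.ne',
    Measure.prod_smul_left, Measure.prod_smul_right, smul_smul,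
    ← ENNReal.ofReal_mul (by positivity)] at h
  have e : |((s ^ 2) ^ Module.finrank ℝ ℝ)⁻¹| * |(s ^ Module.finrank ℝ (Fin m → ℝ))⁻¹|
      = (s ^ (m + 2))⁻¹ := by
    rw [abs_of_pos (by positivity), abs_of_pos (by positivity)]
    simp [pow_add, mul_comm]
  rw [e] at h
  exact h.symm

lemma temperature_eq_integral_parabolic {m : ℕ} {Ω : Set (Euc (m + 1))} (hΩ : IsClosed Ω)
    (z : Euc (m + 1)) (b : OrthonormalBasis (Fin (m + 1)) ℝ (Euc (m + 1))) {s : ℝ} (hs : 0 < s) :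
    temperature Ω (s ^ 2) z =
      (s ^ (m + 2) * (4 * Real.pi * s ^ 2) ^ (-(((m + 1 : ℕ) : ℝ) / 2))) *
        ∫ p, Ω.indicator (fun _ => (1 : ℝ)) (parabolicChart z b s p) * parabolicWeight s p := by
  set G : ℝ × (Fin m → ℝ) → ℝ := fun p =>
    Ω.indicator (heatKernel (s ^ 2) z) (z + (p.1 • b 0 + ∑ i, p.2 i • b i.succ)) with hG
  have hk : Measurable (heatKernel (s ^ 2) z) := by
    unfold heatKernel
    fun_prop
  have hGm : Measurable G := (hk.indicator hΩ.measurableSet).comp (by fun_prop)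
  have h1 : temperature Ω (s ^ 2) z = ∫ p, G p := by
    rw [temperature, ← integral_indicator hΩ.measurableSet,
      integral_eq_integral_normal_tangential z b]
  have h2 : ∫ p : ℝ × (Fin m → ℝ), G (s ^ 2 * p.1, s • p.2) = (s ^ (m + 2))⁻¹ * ∫ p, G p := by
    have h := integral_map (μ := volume) (f := G)
      (φ := fun p : ℝ × (Fin m → ℝ) => (s ^ 2 * p.1, s • p.2)) (by fun_prop)
      hGm.aestronglyMeasurable
    rw [map_parabolic_scaling hs, integral_smul_measure,
      ENNReal.toReal_ofReal (by positivity), smul_eq_mul] at h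
    exact h.symm
  have h3 : ∀ p : ℝ × (Fin m → ℝ), G (s ^ 2 * p.1, s • p.2) = (4 * Real.pi * s ^ 2) ^ (-(((m + 1 : ℕ) : ℝ) / 2)) *
      (Ω.indicator (fun _ => (1 : ℝ)) (parabolicChart z b s p) * parabolicWeight s p) := by
    intro p
    have e : z + ((s ^ 2 * p.1) • b 0 + ∑ i, (s • p.2) i • b i.succ) = parabolicChart z b s p := by
      simp [parabolicChart, Finset.smul_sum, smul_smul]
    simp only [hG, e]
    by_cases hp : parabolicChart z b s p ∈ Ω
    · rw [Set.indicator_of_mem hp, Set.indicator_of_mem hp, heatKernel, parabolicWeight,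
        norm_sub_rev, norm_sq_parabolicChart_sub, one_mul]
      congr 3
      field_simp
    · simp [hp]
  simp_rw [h3] at h2
  rw [integral_const_mul] at h2
  rw [h1, mul_assoc, h2]
  field_simp

/-! ### Gaussian integrals and second moments. -/

lemma integrable_exp_neg_mul_abs {κ : ℝ} (hκ : 0 < κ) :
    Integrable (fun v : ℝ => Real.exp (-κ * |v|)) := by
  rw [← integrableOn_univ, ← Set.Iic_union_Ioi (a := (0 : ℝ))]
  refine IntegrableOn.union ?_ ?_
  · refine (integrableOn_exp_mul_Iic hκ 0).congr_fun (fun v hv => ?_) measurableSet_Iic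
    simp [abs_of_nonpos (Set.mem_Iic.1 hv)]
  · refine (integrableOn_exp_mul_Ioi (neg_neg_of_pos hκ) 0).congr_fun (fun v hv => ?_)
      measurableSet_Ioi
    simp [abs_of_pos (Set.mem_Ioi.1 hv)]

lemma integrable_exp_neg_mul_sum_sq {m : ℕ} {κ : ℝ} (hκ : 0 < κ) :
    Integrable (fun ξ : Fin m → ℝ => Real.exp (-κ * ∑ i, ξ i ^ 2)) := by
  simp_rw [Finset.mul_sum, Real.exp_sum]
  exact Integrable.fintype_prod (f := fun _ x => Real.exp (-κ * x ^ 2))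
    fun _ => integrable_exp_neg_mul_sq hκ

lemma integrable_exp_neg_mul_abs_add_sum_sq {m : ℕ} {κ : ℝ} (hκ : 0 < κ) :
    Integrable (fun p : ℝ × (Fin m → ℝ) => Real.exp (-κ * (|p.1| + ∑ i, p.2 i ^ 2))) := by
  simp_rw [mul_add, Real.exp_add]
  exact (integrable_exp_neg_mul_abs hκ).mul_prod (integrable_exp_neg_mul_sum_sq hκ)

/-- The product of two coordinates has integral `0` against the Gaussian weight if they are
distinct, and a positive integral independent of the coordinate if they agree. -/
lemma exists_gaussian_second_moment (m : ℕ) : ∃ K : ℝ, 0 < K ∧ ∀ i j : Fin m,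
    Integrable (fun ξ : Fin m → ℝ => ξ i * ξ j * Real.exp (-((∑ k, ξ k ^ 2) / 4))) ∧
    ∫ ξ : Fin m → ℝ, ξ i * ξ j * Real.exp (-((∑ k, ξ k ^ 2) / 4)) = if i = j then K else 0 := by
  have hq : (0 : ℝ) < 1 / 4 := by norm_num
  have i0 : Integrable (fun x : ℝ => Real.exp (-(1 / 4) * x ^ 2)) := integrable_exp_neg_mul_sq hq
  have i1 : Integrable (fun x : ℝ => x * Real.exp (-(1 / 4) * x ^ 2)) :=
    integrable_mul_exp_neg_mul_sq hq
  have i2 : Integrable (fun x : ℝ => x * x * Real.exp (-(1 / 4) * x ^ 2)) := by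
    refine (integrable_rpow_mul_exp_neg_mul_sq hq (s := 2) (by norm_num)).congr
      (ae_of_all _ fun x => ?_)
    simp [sq]
  have z1 : ∫ x : ℝ, x * Real.exp (-(1 / 4) * x ^ 2) = 0 := by
    have h := integral_neg_eq_self (fun x : ℝ => x * Real.exp (-(1 / 4) * x ^ 2)) volume
    simp only [neg_mul, integral_neg, neg_sq] at h ⊢
    linarith
  have p0 : 0 < ∫ x : ℝ, Real.exp (-(1 / 4) * x ^ 2) := integral_exp_pos i0
  have p2 : 0 < ∫ x : ℝ, x * x * Real.exp (-(1 / 4) * x ^ 2) := by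
    refine (integral_pos_iff_support_of_nonneg (fun x => mul_nonneg (mul_self_nonneg x) (Real.exp_pos _).le) i2).2 ?_
    have : Function.support (fun x : ℝ => x * x * Real.exp (-(1 / 4) * x ^ 2)) = {0}ᶜ := by
      ext x
      simp
    rw [this]
    exact isOpen_compl_singleton.measure_pos _ ⟨1, by simp⟩
  -- One-variable factors, so that the moment splits into a product of integrals over `ℝ`.
  set w : Fin m → Fin m → Fin m → ℝ → ℝ := fun i j k x =>
    (if k = i then x else 1) * (if k = j then x else 1) * Real.exp (-(1 / 4) * x ^ 2) with hw
  have hprod : ∀ i j (ξ : Fin m → ℝ),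
      ξ i * ξ j * Real.exp (-((∑ k, ξ k ^ 2) / 4)) = ∏ k, w i j k (ξ k) := by
    intro i j ξ
    simp only [hw, Finset.prod_mul_distrib, Finset.prod_ite_eq', Finset.mem_univ, if_true,
      ← Real.exp_sum, ← Finset.mul_sum]
    congr 2
    ring
  refine ⟨(∫ x : ℝ, x * x * Real.exp (-(1 / 4) * x ^ 2)) *
    (∫ x : ℝ, Real.exp (-(1 / 4) * x ^ 2)) ^ (m - 1), by positivity, fun i j => ⟨?_, ?_⟩⟩
  · simp_rw [hprod]
    refine Integrable.fintype_prod fun k => ?_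
    simp only [hw]
    split_ifs
    · exact i2
    · simpa using i1
    · simpa using i1
    · simpa using i0
  · simp_rw [hprod]
    rw [integral_fintype_prod_volume_eq_prod, ← Finset.mul_prod_erase _ _ (Finset.mem_univ i)]
    split_ifs with hij
    · subst hij
      congr 1
      · simp [hw]
      · rw [Finset.prod_congr rfl (g := fun _ => ∫ x : ℝ, Real.exp (-(1 / 4) * x ^ 2))]
        · simp
        · intro k hk
          simp [hw, Finset.ne_of_mem_erase hk]
    · have : ∫ x, w i j i x = 0 := by
        simpa [hw, hij] using z1
      rw [this, zero_mul]

open scoped RealInnerProductSpace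

/-! ### Second order Taylor expansion. -/

lemma hasDerivAt_line_taylor {E : Type*} [NormedAddCommGroup E] [InnerProductSpace ℝ E]
    [CompleteSpace E] {φ : E → ℝ} (z h a k : E) {τ : ℝ} (hφ : DifferentiableAt ℝ φ (z + τ • h)) :
    HasDerivAt (fun τ : ℝ => φ (z + τ • h) - τ * ⟪a, h⟫ - τ ^ 2 / 2 * ⟪k, h⟫)
      ⟪gradient φ (z + τ • h) - a - τ • k, h⟫ τ := by
  have h1 : HasDerivAt (fun τ : ℝ => z + τ • h) h τ := by
    simpa using ((hasDerivAt_id τ).smul_const h).const_add z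
  have h2 := hφ.hasFDerivAt.comp_hasDerivAt τ h1
  rw [← inner_gradient_left] at h2
  have h3 := (h2.sub ((hasDerivAt_id τ).mul_const ⟪a, h⟫)).sub
    ((((hasDerivAt_id τ).pow 2).div_const 2).mul_const ⟪k, h⟫)
  refine HasDerivAt.congr_deriv h3 ?_
  simp only [inner_sub_left, real_inner_smul_left]
  simp

/-- Second order Taylor expansion, in terms of the derivative of the gradient. -/
lemma taylor_two_isLittleO {E : Type*} [NormedAddCommGroup E] [InnerProductSpace ℝ E]
    [CompleteSpace E] {φ : E → ℝ} {z : E} {B : E →L[ℝ] E}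
    (hd : ∀ᶠ x in 𝓝 z, DifferentiableAt ℝ φ x) (hB : HasFDerivAt (gradient φ) B z) :
    (fun h => φ (z + h) - φ z - ⟪gradient φ z, h⟫ - 1 / 2 * ⟪B h, h⟫)
      =o[𝓝 0] fun h => ‖h‖ ^ 2 := by
  rw [Asymptotics.isLittleO_iff]
  intro ε hε
  have hB' := (hasFDerivAt_iff_isLittleO_nhds_zero.1 hB).def hε
  have hd' : ∀ᶠ h in 𝓝 (0 : E), DifferentiableAt ℝ φ (z + h) := by
    have ht : Tendsto (fun h : E => z + h) (𝓝 0) (𝓝 z) := by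
      simpa using (continuous_const_add z).tendsto (0 : E)
    exact ht.eventually hd
  obtain ⟨r, hr, hball⟩ := Metric.eventually_nhds_iff_ball.1 (hB'.and hd')
  filter_upwards [Metric.ball_mem_nhds (0 : E) hr] with h hh
  have hmem : ∀ τ ∈ Set.Icc (0 : ℝ) 1, τ • h ∈ Metric.ball (0 : E) r := by
    intro τ hτ
    rw [mem_ball_zero_iff] at hh ⊢
    rw [norm_smul, Real.norm_of_nonneg hτ.1]
    nlinarith [norm_nonneg h, hτ.2]
  -- Mean value inequality on the segment from `z` to `z + h`: differentiability of the gradient at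
  -- `z` alone bounds the derivative of the Taylor remainder by `ε‖h‖²`.
  have key := norm_image_sub_le_of_norm_deriv_le_segment_01' (C := ε * ‖h‖ ^ 2)
    (f := fun τ : ℝ => φ (z + τ • h) - τ * ⟪gradient φ z, h⟫ - τ ^ 2 / 2 * ⟪B h, h⟫)
    (fun τ hτ => (hasDerivAt_line_taylor z h (gradient φ z) (B h)
      (hball _ (hmem τ hτ)).2).hasDerivWithinAt) ?_
  · have e : φ (z + h) - φ z - ⟪gradient φ z, h⟫ - 1 / 2 * ⟪B h, h⟫
        = (φ (z + h) - ⟪gradient φ z, h⟫ - 1 / 2 * ⟪B h, h⟫) - φ z := by ring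
    rw [e, Real.norm_of_nonneg (sq_nonneg ‖h‖)]
    simpa using key
  · intro τ hτ
    have hτ' := Set.Ico_subset_Icc_self hτ
    have h1 := (hball _ (hmem τ hτ')).1
    rw [map_smul, norm_smul, Real.norm_of_nonneg hτ.1] at h1
    calc ‖⟪gradient φ (z + τ • h) - gradient φ z - τ • B h, h⟫‖
        ≤ ‖gradient φ (z + τ • h) - gradient φ z - τ • B h‖ * ‖h‖ := norm_inner_le_norm _ _
      _ ≤ (ε * (1 * ‖h‖)) * ‖h‖ := by
          gcongr
          exact h1.trans (by gcongr; exact hτ'.2)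
      _ = ε * ‖h‖ ^ 2 := by ring

/-- A second order expansion bounds the deviation from the linear part quadratically. -/
lemma exists_quadratic_bound_of_isLittleO {E : Type*} [NormedAddCommGroup E]
    [InnerProductSpace ℝ E] {g : E → ℝ} {B : E →L[ℝ] E}
    (h : (fun h => g h - 1 / 2 * ⟪B h, h⟫) =o[𝓝 0] fun h => ‖h‖ ^ 2) :
    ∀ᶠ h in 𝓝 (0 : E), |g h| ≤ (1 + ‖B‖) * ‖h‖ ^ 2 := by
  filter_upwards [h.def one_pos] with h hh
  rw [Real.norm_eq_abs, Real.norm_of_nonneg (sq_nonneg ‖h‖)] at hh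
  have h2 : |⟪B h, h⟫| ≤ ‖B‖ * ‖h‖ ^ 2 := by
    calc |⟪B h, h⟫| ≤ ‖B h‖ * ‖h‖ := abs_real_inner_le_norm _ _
      _ ≤ (‖B‖ * ‖h‖) * ‖h‖ := by gcongr; exact B.le_opNorm h
      _ = ‖B‖ * ‖h‖ ^ 2 := by ring
  have h0 : 0 ≤ ‖B‖ * ‖h‖ ^ 2 := by positivity
  rw [abs_le] at hh h2 ⊢
  constructor <;> linarith [hh.1, hh.2, h2.1, h2.2]

/-! ### The defect: domination and pointwise limit. -/

/-- The difference between `Ω` and its tangent half space, in parabolic coordinates. -/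
def halfSpaceDefect {m : ℕ} (Ω : Set (Euc (m + 1))) (z : Euc (m + 1))
    (b : OrthonormalBasis (Fin (m + 1)) ℝ (Euc (m + 1))) (s : ℝ) (p : ℝ × (Fin m → ℝ)) : ℝ :=
  (Ω.indicator (fun _ => (1 : ℝ)) (parabolicChart z b s p)
    - (Set.Iic (0 : ℝ)).indicator (fun _ => 1) p.1) * parabolicWeight s p

lemma inner_normal_parabolicChart_sub {m : ℕ} (z : Euc (m + 1))
    (b : OrthonormalBasis (Fin (m + 1)) ℝ (Euc (m + 1))) (s : ℝ) (p : ℝ × (Fin m → ℝ)) :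
    ⟪b 0, parabolicChart z b s p - z⟫ = s ^ 2 * p.1 := by
  have h : ∀ i : Fin m, ⟪b 0, b i.succ⟫ = 0 := fun i =>
    b.inner_eq_zero (Fin.succ_ne_zero i).symm
  simp [parabolicChart, inner_add_right, real_inner_smul_right, inner_sum, h]

lemma abs_indicator_sub_indicator_le {α β : Type*} (A : Set α) (B : Set β) (x : α) (y : β) :
    |A.indicator (fun _ => (1 : ℝ)) x - B.indicator (fun _ => 1) y| ≤ 1 := by
  by_cases hx : x ∈ A <;> by_cases hy : y ∈ B <;> simp [hx, hy]

/-- The defect is dominated uniformly in `s`. -/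
lemma exists_halfSpaceDefect_bound {m : ℕ} {Ω : Set (Euc (m + 1))} {z : Euc (m + 1)}
    {b : OrthonormalBasis (Fin (m + 1)) ℝ (Euc (m + 1))} {φ : Euc (m + 1) → ℝ} {r C α : ℝ}
    (hr : 0 < r) (hC : 0 < C) (hα : 0 < α)
    (hφ : ∀ h, ‖h‖ < r → (z + h ∈ Ω ↔ φ (z + h) ≤ 0) ∧ |φ (z + h) - α * ⟪b 0, h⟫| ≤ C * ‖h‖ ^ 2) :
    ∃ κ : ℝ, 0 < κ ∧ ∀ s, 0 < s → ∀ p,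
      |halfSpaceDefect Ω z b s p| ≤ Real.exp (-κ * (|p.1| + ∑ i, p.2 i ^ 2)) := by
  -- The entries of the minimum serve, in order, the tangential decay, points at distance at least
  -- `r` from `z`, and points within `r`.
  set κ : ℝ := min 1 (min r (α / C)) / 8 with hκ
  have hm : 0 < min 1 (min r (α / C)) := by positivity
  have hκ0 : 0 < κ := by positivity
  have k1 : κ ≤ 1 / 8 := by
    rw [hκ]; gcongr; exact min_le_left _ _
  have k2 : κ ≤ r / 8 := by
    rw [hκ]; gcongr; exact (min_le_right _ _).trans (min_le_left _ _)
  have k3 : κ * C ≤ α / 8 := by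
    have : κ ≤ (α / C) / 8 := by
      rw [hκ]; gcongr; exact (min_le_right _ _).trans (min_le_right _ _)
    calc κ * C ≤ (α / C) / 8 * C := by gcongr
      _ = α / 8 := by field_simp
  refine ⟨κ, hκ0, fun s hs p => ?_⟩
  obtain ⟨v, ξ⟩ := p
  set N := ∑ i, ξ i ^ 2 with hN
  have hN0 : 0 ≤ N := Finset.sum_nonneg fun i _ => sq_nonneg _
  set X := s ^ 2 * v ^ 2 + N with hX
  have hX0 : 0 ≤ X := by positivity
  have hNX : N ≤ X := by
    have : 0 ≤ s ^ 2 * v ^ 2 := by positivity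
    linarith
  -- Half of the exponent `X / 4` pays for `κ * N`, the other half for `κ * |v|`.
  have main : 8 * κ * |v| ≤ X → |halfSpaceDefect Ω z b s (v, ξ)| ≤ Real.exp (-κ * (|v| + N)) := by
    intro h
    rw [halfSpaceDefect, abs_mul]
    have h1 := abs_indicator_sub_indicator_le Ω (Set.Iic (0 : ℝ)) (parabolicChart z b s (v, ξ)) v
    have h2 : |parabolicWeight s (v, ξ)| ≤ Real.exp (-κ * (|v| + N)) := by
      rw [parabolicWeight, Real.abs_exp]
      apply Real.exp_le_exp.2
      change -(X / 4) ≤ _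
      nlinarith
    exact (mul_le_mul h1 h2 (abs_nonneg _) zero_le_one).trans (one_mul _).le
  have hnorm := norm_sq_parabolicChart_sub z b s (v, ξ)
  have hinner := inner_normal_parabolicChart_sub z b s (v, ξ)
  set h := parabolicChart z b s (v, ξ) - z with hh
  have hγ : parabolicChart z b s (v, ξ) = z + h := by rw [hh]; abel
  change ‖h‖ ^ 2 = s ^ 2 * X at hnorm
  change ⟪b 0, h⟫ = s ^ 2 * v at hinner
  rcases lt_or_ge ‖h‖ r with hlt | hge
  · obtain ⟨hiff, hbd⟩ := hφ h hlt
    rw [hinner, hnorm] at hbd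
    have main' : α * |v| ≤ C * X → |halfSpaceDefect Ω z b s (v, ξ)| ≤ Real.exp (-κ * (|v| + N)) := by
      intro h'
      refine main ?_
      have : κ * C * |v| ≤ α / 8 * |v| := by gcongr
      have h4 : C * (8 * κ * |v|) ≤ C * X := by linarith
      exact le_of_mul_le_mul_left h4 hC
    have hs2 : 0 < s ^ 2 := by positivity
    rw [abs_le] at hbd
    -- A nonzero defect means that `φ (z + h)` and `v` lie on opposite sides of `0`, so `hbd` forces
    -- `α|v| ≤ C X`.
    by_cases hΩ : z + h ∈ Ω <;> by_cases hv : v ≤ 0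
    · have : halfSpaceDefect Ω z b s (v, ξ) = 0 := by simp [halfSpaceDefect, hγ, hΩ, hv]
      rw [this, abs_zero]
      positivity
    · refine main' ?_
      have h0 := hiff.1 hΩ
      rw [abs_of_pos (not_le.1 hv)]
      refine le_of_mul_le_mul_left (a := s ^ 2) ?_ hs2
      linarith [hbd.1]
    · refine main' ?_
      have h0 := not_le.1 (mt hiff.2 hΩ)
      rw [abs_of_nonpos hv]
      refine le_of_mul_le_mul_left (a := s ^ 2) ?_ hs2
      linarith [hbd.2]
    · have : halfSpaceDefect Ω z b s (v, ξ) = 0 := by simp [halfSpaceDefect, hγ, hΩ, hv]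
      rw [this, abs_zero]
      positivity
  · refine main ?_
    -- Away from `z`, multiplying `r² ≤ s²X` by `v²` and using `s²v² ≤ X` removes `s` and gives
    -- `r|v| ≤ X`.
    have h1 : r ^ 2 ≤ s ^ 2 * X := by rw [← hnorm]; gcongr
    have h2 : (r * |v|) ^ 2 ≤ X ^ 2 := by
      rw [mul_pow, sq_abs]
      calc r ^ 2 * v ^ 2 ≤ (s ^ 2 * X) * v ^ 2 := by gcongr
        _ = X * (s ^ 2 * v ^ 2) := by ring
        _ ≤ X * X := by gcongr; linarith
        _ = X ^ 2 := by ring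
    have h3 : r * |v| ≤ X := (pow_le_pow_iff_left₀ (by positivity) hX0 two_ne_zero).1 h2
    have h4 : κ * |v| ≤ r / 8 * |v| := by gcongr
    linarith

/-- The limit of the defect as `s → 0`; here `q` is a quadratic form on the tangent space. -/
def defectLimit {m : ℕ} (q : (Fin m → ℝ) → ℝ) (p : ℝ × (Fin m → ℝ)) : ℝ :=
  ((Set.Iic (-q p.2)).indicator (fun _ => (1 : ℝ)) p.1
    - (Set.Iic (0 : ℝ)).indicator (fun _ => 1) p.1) * Real.exp (-((∑ i, p.2 i ^ 2) / 4))

/-- The scaling makes the normal linear term and the tangential quadratic term both of order `s²`;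
quadratic terms involving the normal direction are of higher order. -/
lemma tendsto_parabolic_quotient {m : ℕ} {z : Euc (m + 1)}
    {b : OrthonormalBasis (Fin (m + 1)) ℝ (Euc (m + 1))} {φ : Euc (m + 1) → ℝ} {α : ℝ}
    {B : Euc (m + 1) →L[ℝ] Euc (m + 1)}
    (hφ : (fun h => (φ (z + h) - α * ⟪b 0, h⟫) - 1 / 2 * ⟪B h, h⟫) =o[𝓝 0] fun h => ‖h‖ ^ 2)
    (p : ℝ × (Fin m → ℝ)) :
    Tendsto (fun s => φ (parabolicChart z b s p) / s ^ 2) (𝓝[>] 0)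
      (𝓝 (α * p.1 + 1 / 2 * ⟪B (∑ i, p.2 i • b i.succ), ∑ i, p.2 i • b i.succ⟫)) := by
  set ζ := ∑ i, p.2 i • b i.succ with hζ
  set k : ℝ → Euc (m + 1) := fun s => (s * p.1) • b 0 + ζ with hk
  have hkc : Continuous k := by fun_prop
  have hk0 : k 0 = ζ := by simp [hk]
  have hγ : ∀ s, parabolicChart z b s p = z + s • k s := by
    intro s
    simp only [parabolicChart, hk, ← hζ, smul_add, smul_smul]
    congr 3
    ring
  have ht : Tendsto (fun s : ℝ => s • k s) (𝓝[>] 0) (𝓝 0) := by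
    have : Continuous fun s : ℝ => s • k s := by fun_prop
    simpa using (this.tendsto 0).mono_left nhdsWithin_le_nhds
  have ho := hφ.comp_tendsto ht
  have hO : (fun s : ℝ => ‖s • k s‖ ^ 2) =O[𝓝[>] 0] fun s => s ^ 2 := by
    have h1 : (fun s : ℝ => ‖k s‖ ^ 2) =O[𝓝[>] 0] fun _ => (1 : ℝ) :=
      (((hkc.norm.pow 2).tendsto 0).mono_left nhdsWithin_le_nhds).isBigO_one ℝ
    have h2 := (Asymptotics.isBigO_refl (fun s : ℝ => s ^ 2) (𝓝[>] 0)).mul h1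
    simpa [norm_smul, mul_pow] using h2
  have hlim := (ho.trans_isBigO hO).tendsto_div_nhds_zero
  have hq : Tendsto (fun s => α * p.1 + 1 / 2 * ⟪B (k s), k s⟫) (𝓝[>] 0)
      (𝓝 (α * p.1 + 1 / 2 * ⟪B ζ, ζ⟫)) := by
    have : Continuous fun s => α * p.1 + 1 / 2 * ⟪B (k s), k s⟫ := by fun_prop
    simpa [hk0] using (this.tendsto 0).mono_left (nhdsWithin_le_nhds (s := Set.Ioi 0))
  have hsum := hlim.add hq
  rw [zero_add] at hsum
  refine hsum.congr' ?_
  filter_upwards [self_mem_nhdsWithin] with s hs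
  have hs0 : s ≠ 0 := (Set.mem_Ioi.1 hs).ne'
  have hin : ⟪b 0, s • k s⟫ = s ^ 2 * p.1 := by
    have := inner_normal_parabolicChart_sub z b s p
    rwa [hγ, add_sub_cancel_left] at this
  simp only [Function.comp_apply, hin, hγ, map_smul, real_inner_smul_left, real_inner_smul_right]
  field_simp
  ring

/-- Off the limiting paraboloid the quotient `φ / s²` has a nonzero limit, so membership in `Ω` is
eventually constant. -/
lemma tendsto_halfSpaceDefect {m : ℕ} {Ω : Set (Euc (m + 1))} {z : Euc (m + 1)}
    {b : OrthonormalBasis (Fin (m + 1)) ℝ (Euc (m + 1))} {φ : Euc (m + 1) → ℝ} {α : ℝ}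
    {B : Euc (m + 1) →L[ℝ] Euc (m + 1)} {q : (Fin m → ℝ) → ℝ} (hα : 0 < α)
    (hq : ∀ ξ, α * q ξ = 1 / 2 * ⟪B (∑ i, ξ i • b i.succ), ∑ i, ξ i • b i.succ⟫)
    (hmem : ∀ᶠ x in 𝓝 z, x ∈ Ω ↔ φ x ≤ 0)
    (hφ : (fun h => (φ (z + h) - α * ⟪b 0, h⟫) - 1 / 2 * ⟪B h, h⟫) =o[𝓝 0] fun h => ‖h‖ ^ 2)
    (p : ℝ × (Fin m → ℝ)) (hp : p.1 ≠ -q p.2) :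
    Tendsto (fun s => halfSpaceDefect Ω z b s p) (𝓝[>] 0) (𝓝 (defectLimit q p)) := by
  have hquot := tendsto_parabolic_quotient hφ p
  rw [← hq, ← mul_add] at hquot
  have hγ : Tendsto (fun s => parabolicChart z b s p) (𝓝[>] 0) (𝓝 z) := by
    have : Continuous fun s => parabolicChart z b s p := by unfold parabolicChart; fun_prop
    simpa [parabolicChart] using (this.tendsto 0).mono_left (nhdsWithin_le_nhds (s := Set.Ioi 0))
  have hw : Tendsto (fun s => parabolicWeight s p) (𝓝[>] 0)
      (𝓝 (Real.exp (-((∑ i, p.2 i ^ 2) / 4)))) := by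
    have : Continuous fun s => parabolicWeight s p := by unfold parabolicWeight; fun_prop
    simpa [parabolicWeight] using (this.tendsto 0).mono_left (nhdsWithin_le_nhds (s := Set.Ioi 0))
  have hind : ∀ᶠ s in 𝓝[>] 0, Ω.indicator (fun _ => (1 : ℝ)) (parabolicChart z b s p)
      = (Set.Iic (-q p.2)).indicator (fun _ => (1 : ℝ)) p.1 := by
    rcases lt_or_gt_of_ne hp with hlt | hgt
    · have hneg : α * (p.1 + q p.2) < 0 := mul_neg_of_pos_of_neg hα (by linarith)
      filter_upwards [hquot.eventually_lt_const hneg, hγ.eventually hmem, self_mem_nhdsWithin]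
        with s h1 h2 hs
      have hs2 : 0 < s ^ 2 := pow_pos hs 2
      have h3 : parabolicChart z b s p ∈ Ω := h2.2 (((div_lt_iff₀ hs2).1 h1).trans_eq (zero_mul _)).le
      rw [Set.indicator_of_mem h3, Set.indicator_of_mem (Set.mem_Iic.2 hlt.le)]
    · have hpos : 0 < α * (p.1 + q p.2) := mul_pos hα (by linarith)
      filter_upwards [hquot.eventually_const_lt hpos, hγ.eventually hmem, self_mem_nhdsWithin]
        with s h1 h2 hs
      have hs2 : 0 < s ^ 2 := pow_pos hs 2
      have h3 : parabolicChart z b s p ∉ Ω := fun h =>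
        absurd (h2.1 h) (not_le.2 ((div_pos_iff_of_pos_right hs2).1 h1))
      rw [Set.indicator_of_notMem h3, Set.indicator_of_notMem (by simpa using hgt)]
  have hlim := hw.const_mul ((Set.Iic (-q p.2)).indicator (fun _ => (1 : ℝ)) p.1
    - (Set.Iic (0 : ℝ)).indicator (fun _ => 1) p.1)
  refine hlim.congr' ?_
  filter_upwards [hind] with s hs
  rw [halfSpaceDefect, hs]

/-! ### Limit of the integrated defect. -/

lemma integral_indicator_Iic_sub_indicator_Iic (a : ℝ) :
    ∫ v, ((Set.Iic a).indicator (fun _ => (1 : ℝ)) v - (Set.Iic (0 : ℝ)).indicator (fun _ => 1) v)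
      = a := by
  rcases le_total 0 a with h | h
  · have e : (fun v => (Set.Iic a).indicator (fun _ => (1 : ℝ)) v
        - (Set.Iic (0 : ℝ)).indicator (fun _ => 1) v) = (Set.Ioc 0 a).indicator fun _ => 1 := by
      ext v
      by_cases h1 : v ≤ a <;> by_cases h2 : v ≤ 0 <;> simp [Set.indicator, h1, h2]
      linarith
    rw [e, integral_indicator measurableSet_Ioc]
    simp [h]
  · have e : (fun v => (Set.Iic a).indicator (fun _ => (1 : ℝ)) v
        - (Set.Iic (0 : ℝ)).indicator (fun _ => 1) v)
          = fun v => -(Set.Ioc a 0).indicator (fun _ => 1) v := by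
      ext v
      by_cases h1 : v ≤ a <;> by_cases h2 : v ≤ 0 <;> simp [Set.indicator, h1, h2]
      linarith
    rw [e, integral_neg, integral_indicator measurableSet_Ioc]
    simp [h]

/-- A graph is null by Fubini: each slice in the first variable is a single point. -/
lemma ae_fst_ne {F : Type*} [MeasureSpace F] [SFinite (volume : Measure F)] {g : F → ℝ}
    (hg : Measurable g) : ∀ᵐ p : ℝ × F, p.1 ≠ g p.2 := by
  have hs : MeasurableSet {p : ℝ × F | p.1 = g p.2} :=
    measurableSet_eq_fun measurable_fst (hg.comp measurable_snd)
  rw [ae_iff]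
  simp only [ne_eq, not_not]
  rw [Measure.volume_eq_prod, Measure.prod_apply_symm hs]
  simp

lemma measurable_halfSpaceDefect {m : ℕ} {Ω : Set (Euc (m + 1))} (hΩ : IsClosed Ω)
    (z : Euc (m + 1)) (b : OrthonormalBasis (Fin (m + 1)) ℝ (Euc (m + 1))) (s : ℝ) :
    Measurable (halfSpaceDefect Ω z b s) := by
  refine Measurable.mul (Measurable.sub ?_ ?_) (continuous_parabolicWeight s).measurable
  · exact (measurable_const.indicator hΩ.measurableSet).comp
      (continuous_parabolicChart z b s).measurable
  · exact (measurable_const.indicator measurableSet_Iic).comp measurable_fst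

lemma tendsto_integral_halfSpaceDefect {m : ℕ} {Ω : Set (Euc (m + 1))} (hΩ : IsClosed Ω)
    {z : Euc (m + 1)} {b : OrthonormalBasis (Fin (m + 1)) ℝ (Euc (m + 1))}
    {φ : Euc (m + 1) → ℝ} {α : ℝ} {B : Euc (m + 1) →L[ℝ] Euc (m + 1)} {q : (Fin m → ℝ) → ℝ}
    (hα : 0 < α) (hqm : Measurable q)
    (hq : ∀ ξ, α * q ξ = 1 / 2 * ⟪B (∑ i, ξ i • b i.succ), ∑ i, ξ i • b i.succ⟫)
    (hmem : ∀ᶠ x in 𝓝 z, x ∈ Ω ↔ φ x ≤ 0)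
    (hφ : (fun h => (φ (z + h) - α * ⟪b 0, h⟫) - 1 / 2 * ⟪B h, h⟫) =o[𝓝 0] fun h => ‖h‖ ^ 2) :
    Tendsto (fun s => ∫ p, halfSpaceDefect Ω z b s p) (𝓝[>] 0)
      (𝓝 (-∫ ξ : Fin m → ℝ, q ξ * Real.exp (-((∑ i, ξ i ^ 2) / 4)))) := by
  have hmem' : ∀ᶠ h in 𝓝 (0 : Euc (m + 1)), z + h ∈ Ω ↔ φ (z + h) ≤ 0 := by
    have ht : Tendsto (fun h : Euc (m + 1) => z + h) (𝓝 0) (𝓝 z) := by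
      simpa using (continuous_const_add z).tendsto (0 : Euc (m + 1))
    exact ht.eventually hmem
  obtain ⟨r, hr, hball⟩ := Metric.eventually_nhds_iff_ball.1
    (hmem'.and (exists_quadratic_bound_of_isLittleO hφ))
  obtain ⟨κ, hκ, hbound⟩ := exists_halfSpaceDefect_bound hr
    (by positivity : 0 < 1 + ‖B‖) hα fun h hh => hball h (mem_ball_zero_iff.2 hh)
  have hne : ∀ᵐ p : ℝ × (Fin m → ℝ), p.1 ≠ -q p.2 := ae_fst_ne hqm.neg
  have hlim : ∀ᵐ p : ℝ × (Fin m → ℝ), Tendsto (fun s => halfSpaceDefect Ω z b s p) (𝓝[>] 0)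
      (𝓝 (defectLimit q p)) := by
    filter_upwards [hne] with p hp
    exact tendsto_halfSpaceDefect hα hq hmem hφ p hp
  have hint := integrable_exp_neg_mul_abs_add_sum_sq (m := m) hκ
  have hdct := tendsto_integral_filter_of_dominated_convergence (l := 𝓝[>] (0 : ℝ))
    (F := fun s => halfSpaceDefect Ω z b s) (f := defectLimit q) _
    (Eventually.of_forall fun s => (measurable_halfSpaceDefect hΩ z b s).aestronglyMeasurable)
    (by
      filter_upwards [self_mem_nhdsWithin] with s hs
      exact ae_of_all _ fun p => hbound s hs p) hint hlim
  -- The limit inherits the majorant; integrability is needed for Fubini below.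
  have hLint : Integrable (defectLimit q) := by
    refine hint.mono' (aestronglyMeasurable_of_tendsto_ae (𝓝[>] (0 : ℝ))
      (fun s => (measurable_halfSpaceDefect hΩ z b s).aestronglyMeasurable) hlim) ?_
    filter_upwards [hlim] with p hp
    refine le_of_tendsto hp.norm ?_
    filter_upwards [self_mem_nhdsWithin] with s hs
    exact hbound s hs p
  have hval : ∫ p, defectLimit q p
      = -∫ ξ : Fin m → ℝ, q ξ * Real.exp (-((∑ i, ξ i ^ 2) / 4)) := by
    rw [Measure.volume_eq_prod, integral_prod_symm _ hLint, ← integral_neg]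
    refine integral_congr_ae (ae_of_all _ fun ξ => ?_)
    simp only [defectLimit]
    rw [integral_mul_const, integral_indicator_Iic_sub_indicator_Iic, neg_mul]
  rwa [hval] at hdct


/-! ### Trace of the Weingarten map. -/

/-- On tangent vectors, the Weingarten map is the derivative of the gradient divided by the length
of the gradient. -/
lemma inner_weingartenMap {n : ℕ} {φ : Euc n → ℝ} {z : Euc n} {B : Euc n →L[ℝ] Euc n}
    (hB : HasFDerivAt (gradient φ) B z) (h0 : gradient φ z ≠ 0) (ξ : tangentPlane φ z) :
    ⟪ξ, weingartenMap φ z ξ⟫ = ‖gradient φ z‖⁻¹ * ⟪B ξ, (ξ : Euc n)⟫ := by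
  -- Differentiating the scalar factor `‖∇φ‖⁻¹` contributes only a multiple of `∇φ z`, which `ξ`
  -- does not see.
  have hd : DifferentiableAt ℝ (fun x => ‖gradient φ x‖⁻¹) z :=
    (hB.differentiableAt.norm ℝ h0).inv (norm_ne_zero_iff.2 h0)
  have hν : HasFDerivAt (unitNormal φ) _ z := hd.hasFDerivAt.smul hB
  have horth : ⟪(ξ : Euc n), gradient φ z⟫ = 0 := by
    rw [real_inner_comm]
    exact Submodule.mem_orthogonal_singleton_iff_inner_right.1 ξ.2
  have h1 : weingartenMap φ z ξ =
      (tangentPlane φ z).orthogonalProjectionOnto (fderiv ℝ (unitNormal φ) z ξ) := rfl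
  rw [h1, Submodule.inner_orthogonalProjectionOnto_eq_of_mem_left, hν.fderiv]
  simp [inner_add_right, real_inner_smul_right, horth, real_inner_comm]

lemma exists_orthonormalBasis_zero_eq {m : ℕ} {u : Euc (m + 1)} (hu : ‖u‖ = 1) :
    ∃ b : OrthonormalBasis (Fin (m + 1)) ℝ (Euc (m + 1)), b 0 = u := by
  obtain ⟨b, hb⟩ := Orthonormal.exists_orthonormalBasis_extension_of_card_eq (𝕜 := ℝ)
    (E := Euc (m + 1)) (ι := Fin (m + 1)) (by simp) (v := fun _ => u) (s := {0})
    ⟨fun _ => hu, fun i j hij => absurd (Subsingleton.elim i j) hij⟩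
  exact ⟨b, hb 0 rfl⟩

lemma trace_weingartenMap_eq_sum {m : ℕ} {φ : Euc (m + 1) → ℝ} {z : Euc (m + 1)}
    {B : Euc (m + 1) →L[ℝ] Euc (m + 1)} (hB : HasFDerivAt (gradient φ) B z)
    (h0 : gradient φ z ≠ 0) (b : OrthonormalBasis (Fin (m + 1)) ℝ (Euc (m + 1)))
    (hb : gradient φ z = ‖gradient φ z‖ • b 0) :
    LinearMap.trace ℝ (tangentPlane φ z) (weingartenMap φ z)
      = ‖gradient φ z‖⁻¹ * ∑ i : Fin m, ⟪B (b i.succ), b i.succ⟫ := by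
  have hmem : ∀ i : Fin m, b i.succ ∈ tangentPlane φ z := by
    intro i
    refine Submodule.mem_orthogonal_singleton_iff_inner_right.2 ?_
    rw [hb, real_inner_smul_left, b.inner_eq_zero (Fin.succ_ne_zero i).symm, mul_zero]
  set e : Fin m → tangentPlane φ z := fun i => ⟨b i.succ, hmem i⟩ with he
  have hon : Orthonormal ℝ e :=
    (b.orthonormal.comp Fin.succ (Fin.succ_injective m)).codRestrict (tangentPlane φ z) hmem
  have hfin : Module.finrank ℝ (tangentPlane φ z) = m := by
    have : Fact (Module.finrank ℝ (Euc (m + 1)) = m + 1) := ⟨by simp⟩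
    exact Submodule.finrank_orthogonal_span_singleton h0
  have hspan : ⊤ ≤ Submodule.span ℝ (Set.range e) :=
    (hon.linearIndependent.span_eq_top_of_card_eq_finrank' (by simp [hfin])).ge
  rw [LinearMap.trace_eq_sum_inner _ (OrthonormalBasis.mk hon hspan), Finset.mul_sum]
  refine Finset.sum_congr rfl fun i _ => ?_
  rw [OrthonormalBasis.coe_mk, inner_weingartenMap hB h0]

lemma integral_quadraticForm_mul_gaussian {m : ℕ} {K : ℝ}
    (hK : ∀ i j : Fin m,
      Integrable (fun ξ : Fin m → ℝ => ξ i * ξ j * Real.exp (-((∑ k, ξ k ^ 2) / 4))) ∧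
      ∫ ξ : Fin m → ℝ, ξ i * ξ j * Real.exp (-((∑ k, ξ k ^ 2) / 4)) = if i = j then K else 0)
    (c : Fin m → Fin m → ℝ) :
    ∫ ξ : Fin m → ℝ, (∑ i, ∑ j, c i j * (ξ i * ξ j)) * Real.exp (-((∑ k, ξ k ^ 2) / 4))
      = K * ∑ i, c i i := by
  have e : ∀ ξ : Fin m → ℝ,
      (∑ i, ∑ j, c i j * (ξ i * ξ j)) * Real.exp (-((∑ k, ξ k ^ 2) / 4))
      = ∑ i, ∑ j, c i j * (ξ i * ξ j * Real.exp (-((∑ k, ξ k ^ 2) / 4))) := by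
    intro ξ
    simp only [Finset.sum_mul, mul_assoc]
  simp_rw [e]
  rw [integral_finsetSum _ fun i _ =>
    integrable_finsetSum _ fun j _ => (hK i j).1.const_mul _]
  rw [Finset.mul_sum]
  refine Finset.sum_congr rfl fun i _ => ?_
  rw [integral_finsetSum _ fun j _ => (hK i j).1.const_mul _]
  simp only [integral_const_mul, (hK _ _).2, mul_ite, mul_zero, Finset.sum_ite_eq,
    Finset.mem_univ, if_true]
  ring

/-! ### From the defect to the mean curvature. -/

/-- In parabolic coordinates at a smooth boundary point, the defect between `Ω` and its tangent
half space tends to a negative multiple of the mean curvature. -/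
lemma exists_tendsto_integral_halfSpaceDefect (m : ℕ) (hm : 0 < m) : ∃ K : ℝ, 0 < K ∧
    ∀ (Ω : Set (Euc (m + 1))) (z : Euc (m + 1)) (H : ℝ), IsClosed Ω → HasMeanCurvatureAt Ω z H →
      ∃ b : OrthonormalBasis (Fin (m + 1)) ℝ (Euc (m + 1)),
        Tendsto (fun s => ∫ p, halfSpaceDefect Ω z b s p) (𝓝[>] 0) (𝓝 (-(K * H))) := by
  obtain ⟨K, hK0, hK⟩ := exists_gaussian_second_moment m
  -- The form `q` is half the second fundamental form, whose trace is `m·H`; hence the factor `m /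
  -- 2` on the moment `K`.
  refine ⟨K * m / 2, by positivity, ?_⟩
  rintro Ω z H hΩ ⟨U, φ, hdef, rfl⟩
  have hU : U ∈ 𝓝 z := hdef.isOpen.mem_nhds hdef.mem
  have h0 := hdef.gradient_ne_zero
  have hα : 0 < ‖gradient φ z‖ := norm_pos_iff.2 h0
  obtain ⟨b, hb⟩ := exists_orthonormalBasis_zero_eq (u := ‖gradient φ z‖⁻¹ • gradient φ z)
    (by rw [norm_smul, norm_inv, norm_norm, inv_mul_cancel₀ hα.ne'])
  have hb' : gradient φ z = ‖gradient φ z‖ • b 0 := by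
    rw [hb, smul_smul, mul_inv_cancel₀ hα.ne', one_smul]
  have hd : ∀ᶠ x in 𝓝 z, DifferentiableAt ℝ φ x := by
    filter_upwards [hdef.isOpen.mem_nhds hdef.mem] with x hx
    exact (hdef.smooth.contDiffAt (hdef.isOpen.mem_nhds hx)).differentiableAt (by simp)
  have hB : HasFDerivAt (gradient φ) (fderiv ℝ (gradient φ) z) z := by
    have h1 : ContDiffAt ℝ 1 (fderiv ℝ φ) z :=
      (hdef.smooth.contDiffAt hU).fderiv_right (m := 1) (by norm_cast)
    have h2 : DifferentiableAt ℝ (fderiv ℝ φ) z := h1.differentiableAt (by simp)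
    exact ((InnerProductSpace.toDual ℝ (Euc (m + 1))).symm.differentiableAt.comp z h2).hasFDerivAt
  set B := fderiv ℝ (gradient φ) z
  set α := ‖gradient φ z‖ with hαdef
  set c : Fin m → Fin m → ℝ := fun i j => (2 * α)⁻¹ * ⟪B (b i.succ), b j.succ⟫ with hc
  have htaylor : (fun h => (φ (z + h) - α * ⟪b 0, h⟫) - 1 / 2 * ⟪B h, h⟫)
      =o[𝓝 0] fun h => ‖h‖ ^ 2 := by
    refine (taylor_two_isLittleO hd hB).congr_left fun h => ?_
    rw [hdef.eq_zero, hb', real_inner_smul_left, sub_zero]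
  have hmem : ∀ᶠ x in 𝓝 z, x ∈ Ω ↔ φ x ≤ 0 := by
    filter_upwards [hU] with x hx using hdef.mem_iff x hx
  have hlim := tendsto_integral_halfSpaceDefect hΩ (b := b)
    (q := fun ξ => ∑ i, ∑ j, c i j * (ξ i * ξ j)) hα (by fun_prop) (fun ξ => by
      simp only [map_sum, map_smul, sum_inner, inner_sum, real_inner_smul_left,
        real_inner_smul_right, Finset.mul_sum, hc]
      rw [Finset.sum_comm]
      refine Finset.sum_congr rfl fun i _ => Finset.sum_congr rfl fun j _ => ?_
      field_simp) hmem htaylor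
  rw [integral_quadraticForm_mul_gaussian hK] at hlim
  refine ⟨b, ?_⟩
  convert hlim using 3
  rw [trace_weingartenMap_eq_sum hB h0 b hb', ← Finset.mul_sum]
  have hm' : (m : ℝ) ≠ 0 := by positivity
  push_cast
  rw [add_sub_cancel_right, ← hαdef]
  field_simp

lemma integrable_parabolicWeight {m : ℕ} {s : ℝ} (hs : 0 < s) :
    Integrable (parabolicWeight (m := m) s) := by
  have h : parabolicWeight (m := m) s = fun p =>
      Real.exp (-(s ^ 2 / 4) * p.1 ^ 2) * Real.exp (-(1 / 4) * ∑ i, p.2 i ^ 2) := by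
    ext p
    rw [parabolicWeight, ← Real.exp_add]
    ring_nf
  rw [h]
  exact (integrable_exp_neg_mul_sq (by positivity)).mul_prod
    (integrable_exp_neg_mul_sum_sq (by norm_num))

/-- For fixed `s > 0` the weight is still integrable, so the two terms separate; the second involves
neither `Ω` nor `z` nor `b`. -/
lemma integral_halfSpaceDefect {m : ℕ} {Ω : Set (Euc (m + 1))} (hΩ : IsClosed Ω)
    (z : Euc (m + 1)) (b : OrthonormalBasis (Fin (m + 1)) ℝ (Euc (m + 1))) {s : ℝ} (hs : 0 < s) :
    ∫ p, halfSpaceDefect Ω z b s p =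
      (∫ p, Ω.indicator (fun _ => (1 : ℝ)) (parabolicChart z b s p) * parabolicWeight s p)
      - ∫ p : ℝ × (Fin m → ℝ), (Set.Iic (0 : ℝ)).indicator (fun _ => 1) p.1
          * parabolicWeight s p := by
  have hw := integrable_parabolicWeight (m := m) hs
  simp only [halfSpaceDefect, sub_mul]
  refine integral_sub ?_ ?_
  · refine hw.bdd_mul (c := 1) ((measurable_const.indicator hΩ.measurableSet).comp
      (continuous_parabolicChart z b s).measurable).aestronglyMeasurable (ae_of_all _ fun p => ?_)
    by_cases hp : parabolicChart z b s p ∈ Ω <;> simp [hp]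
  · refine hw.bdd_mul (c := 1) ((measurable_const.indicator measurableSet_Iic).comp
      measurable_fst).aestronglyMeasurable (ae_of_all _ fun p => ?_)
    by_cases hp : p.1 ≤ 0 <;> simp [hp]

end HeatComparison

end

theorem mainTheorem10 (n : ℕ) (hn : 2 ≤ n)
    (Ω : Set (HeatComparison.Euc n)) (hΩ : HeatComparison.IsAdmissible Ω)
    (z₁ z₂ : HeatComparison.Euc n) (H₁ H₂ : ℝ)
    (h₁ : HeatComparison.HasMeanCurvatureAt Ω z₁ H₁)
    (h₂ : HeatComparison.HasMeanCurvatureAt Ω z₂ H₂)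
    (hH : H₁ < H₂) :
    HeatComparison.InitiallyStrictlyHotter z₁ Ω z₂ Ω := by
  obtain ⟨m, rfl⟩ : ∃ m, n = m + 1 := ⟨n - 1, by omega⟩
  obtain ⟨K, hK, hlim⟩ := HeatComparison.exists_tendsto_integral_halfSpaceDefect m (by omega)
  obtain ⟨b₁, hb₁⟩ := hlim Ω z₁ H₁ hΩ.1 h₁
  obtain ⟨b₂, hb₂⟩ := hlim Ω z₂ H₂ hΩ.1 h₂
  have hlt : -(K * H₂) < -(K * H₁) := neg_lt_neg (mul_lt_mul_of_pos_left hH hK)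
  obtain ⟨σ, hσ, hsub⟩ := mem_nhdsGT_iff_exists_Ioo_subset.1 (hb₂.eventually_lt hb₁ hlt)
  have hσ0 : (0 : ℝ) < σ := hσ
  -- The defect integrals are strictly ordered for `s < σ`, and `t = s²`.
  refine ⟨σ ^ 2, by positivity, fun t ht => ?_⟩
  have hs : 0 < √t := Real.sqrt_pos.2 ht.1
  have hst : √t < σ := (Real.sqrt_lt' hσ0).2 ht.2
  have hdefect := hsub ⟨hs, hst⟩
  simp only [Set.mem_ofPred_eq] at hdefect
  rw [HeatComparison.integral_halfSpaceDefect hΩ.1 z₁ b₁ hs,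
    HeatComparison.integral_halfSpaceDefect hΩ.1 z₂ b₂ hs] at hdefect
  rw [← Real.sq_sqrt ht.1.le, HeatComparison.temperature_eq_integral_parabolic hΩ.1 z₁ b₁ hs,
    HeatComparison.temperature_eq_integral_parabolic hΩ.1 z₂ b₂ hs]
  have hc : 0 < 4 * Real.pi * √t ^ 2 := by positivity
  exact mul_lt_mul_of_pos_left (by linarith)
    (mul_pos (pow_pos hs _) (Real.rpow_pos_of_pos hc _))
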